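/- Let $0\le K<N$, $R\ge 1$ be integers, $\beta>0$, and let $H$ be a Hermitian $2^N\times 2^N$ matrix. Put $\rho_G=e^{-\beta H}/\mathrm{Tr}(e^{-\beta H})$ and $\mathcal F(\rho)=\mathrm{Tr}(H\rho)-\beta^{-1}S(\rho)$, where $S(\rho)=-\mathrm{Tr}(\rho\ln\rho)$. Let $C_0=\sum_{k=1}^R \frac1k$ and $C_j=\sum_{k=j}^R\binom kj\frac{(-1)^j}{k}$ for $1\le j\le R$ (so $C_R=(-1)^R/R$); the $R$-truncated free energy of a state $\rho$ is $\mathcal F_R(\rho)=\mathrm{Tr}(H\rho)-\beta^{-1}\sum_{j=0}^R C_j\mathrm{Tr}(\rho^{j+1})$. Let $\rho(\gamma)$ be a parametrized family of $N$-qubit density matrices and $U(\theta)$ a parametrized family of $2^N\times2^N$ unitaries (the encoders of the quantum auto-encoder, QAE). Let $P=(|0\rangle\langle 0|)^{\otimes (N-K)}\otimes \mathbb I_K$ and $M_G=\mathbb I_N-P$. Let $\hat\gamma,\hat\theta$ be the trained parameters, write $\rho=\rho(\hat\gamma)$ and $U=U(\hat\theta)$, let $r$ be the rank of $\rho$, and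 let $\delta=\mathrm{Tr}(M_G\,U\rho U^\dagger)$ be the training loss of QAE; assume $\delta<1$. Let $\hat\lambda_1,\dots,\hat\lambda_{2^K}$ be the eigenvalues of the compressed state $$\hat\sigma=\mathrm{Tr}_E\left(\frac{P\,U\rho U^\dagger P^\dagger}{\mathrm{Tr}(P\,U\rho U^\dagger)}\right),$$ where $\mathrm{Tr}_E$ is the partial trace over the first $N-K$ qubits, and let $$\hat{\mathcal F}_R(\rho)=\mathrm{Tr}(H\rho)-\frac1\beta\sum_{j=0}^R C_j\sum_{i=1}^{2^K}\hat\lambda_i^{\,j+1}$$ be the $R$-truncated free energy as evaluated with the eigenvalues supplied by QAE. Suppose that the solver has reached the tolerable error $\epsilon_1\ge 0$, that is, $\hat{\mathcal F}_R(\rho)\le \mathcal F(\rho_G)+\epsilon_1$. Let $\Delta\in(0,e^{-1})$. Then the fidelity $\mathrm F(\rho_G,\rho)=\mathrm{Tr}\sqrt{\sqrt{\rho_G}\,\rho\sqrt{\rho_G}}$ satisfies $$\mathrm F(\rho_G,\rho(\hat\gamma))\ \ge\ 1-\sqrt{2\beta\epsilon+\frac{C_{\max}\,\delta}{1-\delta}},\qquad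 \epsilon=\epsilon_1+\frac{2r}{R+1}(1-\Delta)^{R+1},$$ with $C_{\max}=\max_{0\le j\le R}C_j$; if $R\ge2$, the same bound holds with $C_{\max}=\max_{1\le j\le R}C_j$. -/

import Mathlib

open scoped Matrix Kronecker ComplexOrder

noncomputable section

namespace QAEGibbs

/-- Labels of the computational basis of `n` qubits. -/
abbrev Qubits (n : ℕ) : Type := Fin n → Fin 2

/-- Labels of the computational basis of `N` qubits, split into the first `N - K` qubits (the
environment `E`, discarded by the encoder) and the last `K` qubits (the latent space). It is
used for `K < N` only. -/
abbrev Register (N K : ℕ) : Type := Qubits (N - K) × Qubits K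

/-- Density matrices: positive semidefinite, of trace one. -/
def IsDensityMatrix {ι : Type*} [Fintype ι] (ρ : Matrix ι ι ℂ) : Prop :=
  ρ.PosSemidef ∧ ρ.trace = 1

section States

variable {ι : Type*} [Fintype ι] [DecidableEq ι]

/-- The square root of a positive semidefinite matrix, by functional calculus. -/
def matSqrt (A : Matrix ι ι ℂ) : Matrix ι ι ℂ := cfc Real.sqrt A

/-- The fidelity `F(ρ, κ) = Tr √(√ρ κ √ρ)`. -/
def fidelity (ρ κ : Matrix ι ι ℂ) : ℝ :=
  (matSqrt (matSqrt ρ * κ * matSqrt ρ)).trace.re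

/-- The Gibbs state `e^{-βH} / Tr e^{-βH}`. -/
def gibbsState (β : ℝ) (H : Matrix ι ι ℂ) : Matrix ι ι ℂ :=
  (NormedSpace.exp (-(β : ℂ) • H)).trace⁻¹ • NormedSpace.exp (-(β : ℂ) • H)

/-- The von Neumann entropy `S(ρ) = -Tr(ρ ln ρ)`. -/
def vonNeumannEntropy (ρ : Matrix ι ι ℂ) : ℝ :=
  -(ρ * cfc Real.log ρ).trace.re

/-- The free energy `Tr(Hρ) - β⁻¹ S(ρ)`. -/
def freeEnergy (β : ℝ) (H ρ : Matrix ι ι ℂ) : ℝ :=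
  (H * ρ).trace.re - β⁻¹ * vonNeumannEntropy ρ

end States

/-- The coefficients `C_0, …, C_R` of the `R`-truncated entropy
`S_R(ρ) = ∑_{j=0}^R C_j Tr(ρ^{j+1})`; in particular `C_R = (-1)^R / R`. -/
def truncCoeff (R j : ℕ) : ℝ :=
  if j = 0 then ∑ k ∈ Finset.Icc 1 R, 1 / (k : ℝ)
  else ∑ k ∈ Finset.Icc j R, (k.choose j : ℝ) * (-1) ^ j / (k : ℝ)

section AutoEncoder

variable {N K : ℕ}

/-- The projector `(|0⟩⟨0|)^{⊗(N-K)} ⊗ 𝕀_K`. -/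
def zeroProj (N K : ℕ) : Matrix (Register N K) (Register N K) ℂ :=
  (Matrix.single (0 : Qubits (N - K)) 0 (1 : ℂ)) ⊗ₖ (1 : Matrix (Qubits K) (Qubits K) ℂ)

/-- The measurement operator `M_G = 𝕀_N - (|0⟩⟨0|)^{⊗(N-K)} ⊗ 𝕀_K`. -/
def measG (N K : ℕ) : Matrix (Register N K) (Register N K) ℂ := 1 - zeroProj N K

/-- The training loss `Tr(M_G U ρ U†)` of the quantum auto-encoder with encoder `U`. -/
def qaeLoss (U ρ : Matrix (Register N K) (Register N K) ℂ) : ℝ :=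
  (measG N K * (U * ρ * Uᴴ)).trace.re

/-- The partial trace over all qubits except the `K` latent ones. -/
def partialTraceE (A : Matrix (Register N K) (Register N K) ℂ) :
    Matrix (Qubits K) (Qubits K) ℂ :=
  Matrix.of fun a b => ∑ e : Qubits (N - K), A (e, a) (e, b)

/-- The compressed state `Tr_E(P U ρ U† P† / Tr(P U ρ U†))` of the auto-encoder, where
`P = (|0⟩⟨0|)^{⊗(N-K)} ⊗ 𝕀_K`. -/
def compressedState (U ρ : Matrix (Register N K) (Register N K) ℂ) :
    Matrix (Qubits K) (Qubits K) ℂ :=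
  partialTraceE ((zeroProj N K * (U * ρ * Uᴴ)).trace.re⁻¹ •
    (zeroProj N K * (U * ρ * Uᴴ) * (zeroProj N K)ᴴ))

theorem compressedState_isHermitian (U : Matrix (Register N K) (Register N K) ℂ)
    {ρ : Matrix (Register N K) (Register N K) ℂ} (hρ : ρ.IsHermitian) :
    (compressedState U ρ).IsHermitian := by
  have h : ((zeroProj N K * (U * ρ * Uᴴ)).trace.re⁻¹ •
      (zeroProj N K * (U * ρ * Uᴴ) * (zeroProj N K)ᴴ)).IsHermitian := by
    rw [Matrix.IsHermitian, Matrix.conjTranspose_smul]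
    rw [(Matrix.isHermitian_mul_mul_conjTranspose (zeroProj N K)
      (Matrix.isHermitian_mul_mul_conjTranspose U hρ)).eq, star_trivial]
  ext a b
  simp only [compressedState, partialTraceE, Matrix.conjTranspose_apply, Matrix.of_apply,
    star_sum]
  exact Finset.sum_congr rfl fun e _ => h.apply _ _

/-- The eigenvalues `λ̂_i` (`2^K` of them, with multiplicity) of the compressed state. -/
def qaeEigenvalues (U : Matrix (Register N K) (Register N K) ℂ)
    {ρ : Matrix (Register N K) (Register N K) ℂ} (hρ : ρ.IsHermitian) : Qubits K → ℝ :=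
  (compressedState_isHermitian U hρ).eigenvalues

/-- The `R`-truncated free energy of `ρ` as the QAE-based solver evaluates it: `Tr(ρ^{j+1})` is
replaced by `∑ i, λ̂_i^{j+1}`, with `λ̂_i` the eigenvalues of the compressed state. -/
def qaeTruncFreeEnergy (β : ℝ) (H : Matrix (Register N K) (Register N K) ℂ) (R : ℕ)
    (U : Matrix (Register N K) (Register N K) ℂ)
    {ρ : Matrix (Register N K) (Register N K) ℂ} (hρ : ρ.IsHermitian) : ℝ :=
  (H * ρ).trace.re -
    β⁻¹ * ∑ j ∈ Finset.range (R + 1), truncCoeff R j * ∑ i, qaeEigenvalues U hρ i ^ (j + 1)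

end AutoEncoder

end QAEGibbs

end

/-!
The proof compares free energies and then passes from free energy to fidelity.

*From free energy to fidelity.* The excess `β * (F(ρ) - F(ρ_G))` is the relative entropy `D` of `ρ`
with respect to the Gibbs state. Expanding `ρ` and `ρ_G` in their eigenbases, with eigenvalues `p i`
and `q j`, and writing `w i j` for the squared moduli of the overlaps, `D` becomes the relative
entropy of the classical distributions `w i j * p i` and `w i j * q j`, and `Tr (√ρ √ρ_G)` their
Bhattacharyya coefficient. Jensen's inequality gives `exp (-D / 2) ≤ Tr (√ρ √ρ_G)`, and the latter is
at most the trace norm of `√ρ √ρ_G`, which is the fidelity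
(`exp_neg_freeEnergy_sub_le_fidelity`).

*Truncation and compression.* The polynomial `s(x) = ∑ j, C_j * x ^ (j + 1)` is
`x * ∑_{k=1}^R (1 - x) ^ k / k`, so `s(x) ≤ -x log x` on `[0, 1]`: truncation only lowers the
entropy, and the truncation term in `ε` is needed only to be nonnegative. Moreover `s` is concave on
`[0, 1]` with slopes in `[-1, C_0]`. The compressed state is the normalized compression of `ρ` by an
isometry, and Klein's inequality for `s` shows that its truncated entropy exceeds the entropy of `ρ`
by at most `(C_0 + 1) * δ` (`sum_truncEntropyFun_le_of_compression`). Hence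
`D ≤ β * ε₁ + (C_0 + 1) * δ`.

*Constants.* In both cases `C_max ≥ 1 / 4` and `C_0 ≤ 1 + C_max`; in the second one already `C_2` has
these properties. With `y` the square root in the claim this gives `D ≤ 2 * y + y ^ 2`, and
`exp (-y - y ^ 2 / 2) ≥ 1 - y` (`one_sub_sqrt_le_exp`).
-/

open scoped Matrix Kronecker ComplexOrder

namespace QAEGibbs

/-! ### The truncated logarithm -/

/-- The partial sum `∑_{k=1}^R (1-x)^k / k` of the Taylor series of `-log x` at `1`. -/
noncomputable def truncNegLog (R : ℕ) (x : ℝ) : ℝ :=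
  ∑ k ∈ Finset.range R, (1 - x) ^ (k + 1) / ((k : ℝ) + 1)

/-- The summand `s(x) = x * truncNegLog R x` of the truncated entropy, an approximation from below
of `-x log x`. -/
noncomputable def truncEntropyFun (R : ℕ) (x : ℝ) : ℝ := x * truncNegLog R x

/-- The derivative of `truncEntropyFun R`. -/
noncomputable def truncEntropyDeriv (R : ℕ) (x : ℝ) : ℝ := truncNegLog R x - 1 + (1 - x) ^ R

theorem sum_range_eq_sum_Icc_one (R : ℕ) (g : ℕ → ℝ) :
    ∑ k ∈ Finset.range R, g (k + 1) = ∑ k ∈ Finset.Icc 1 R, g k := by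
  rw [Finset.range_eq_Ico, Finset.sum_Ico_add' g 0 R 1]
  rfl

theorem truncNegLog_eq_sum_Icc (R : ℕ) (x : ℝ) :
    truncNegLog R x = ∑ k ∈ Finset.Icc 1 R, (1 - x) ^ k / (k : ℝ) := by
  rw [← sum_range_eq_sum_Icc_one R fun k => (1 - x) ^ k / (k : ℝ)]
  simp [truncNegLog]

theorem truncCoeff_eq_sum (R j : ℕ) :
    truncCoeff R j = ∑ k ∈ Finset.Icc 1 R, (k.choose j : ℝ) * (-1) ^ j / (k : ℝ) := by
  rcases Nat.eq_zero_or_pos j with rfl | hj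
  · simp [truncCoeff]
  · rw [truncCoeff, if_neg hj.ne']
    refine Finset.sum_subset (Finset.Icc_subset_Icc_left hj) fun k hk hk' => ?_
    simp only [Finset.mem_Icc] at hk hk'
    rw [Nat.choose_eq_zero_of_lt (by omega)]
    simp

theorem truncNegLog_zero (R : ℕ) : truncNegLog R 0 = truncCoeff R 0 := by
  rw [truncNegLog_eq_sum_Icc, truncCoeff_eq_sum]
  simp

/-- The coefficients `C_j` are those of the polynomial `x * truncNegLog R x`, by the binomial
theorem. -/
theorem sum_truncCoeff_mul_pow (R : ℕ) (x : ℝ) :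
    ∑ j ∈ Finset.range (R + 1), truncCoeff R j * x ^ (j + 1) = truncEntropyFun R x := by
  rw [truncEntropyFun, truncNegLog_eq_sum_Icc]
  simp only [truncCoeff_eq_sum, Finset.sum_mul]
  rw [Finset.sum_comm, Finset.mul_sum]
  refine Finset.sum_congr rfl fun k hk => ?_
  have hk' := (Finset.mem_Icc.1 hk).2
  rw [show (1 - x) ^ k = ((-x) + 1) ^ k by ring, add_pow,
    Finset.sum_subset (Finset.range_mono (Nat.succ_le_succ hk'))
      (fun j _ hj => by
        rw [Nat.choose_eq_zero_of_lt (by simpa using hj)]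
        simp), Finset.sum_div, Finset.mul_sum]
  refine Finset.sum_congr rfl fun j _ => ?_
  rw [neg_pow x j]
  ring

theorem truncNegLog_nonneg (R : ℕ) {x : ℝ} (hx : x ≤ 1) : 0 ≤ truncNegLog R x :=
  Finset.sum_nonneg fun k _ => div_nonneg (pow_nonneg (by linarith) _) (by positivity)

theorem truncNegLog_antitoneOn (R : ℕ) : AntitoneOn (truncNegLog R) (Set.Iic 1) := by
  intro x hx y hy hxy
  have hy' : y ≤ 1 := hy
  refine Finset.sum_le_sum fun k _ => ?_
  gcongr

theorem truncNegLog_le_neg_log (R : ℕ) {x : ℝ} (hx0 : 0 < x) (hx1 : x ≤ 1) :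
    truncNegLog R x ≤ -Real.log x := by
  have h := Real.hasSum_pow_div_log_of_abs_lt_one (x := 1 - x)
    (by rw [abs_lt]; constructor <;> linarith)
  rw [sub_sub_cancel] at h
  exact sum_le_hasSum _ (fun k _ => div_nonneg (pow_nonneg (by linarith) _) (by positivity)) h

theorem truncEntropyFun_le_negMulLog (R : ℕ) {x : ℝ} (hx0 : 0 ≤ x) (hx1 : x ≤ 1) :
    truncEntropyFun R x ≤ -(x * Real.log x) := by
  rcases hx0.eq_or_lt with rfl | hx
  · simp [truncEntropyFun]
  · rw [truncEntropyFun, ← mul_neg]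
    exact mul_le_mul_of_nonneg_left (truncNegLog_le_neg_log R hx hx1) hx0

theorem hasDerivAt_truncEntropyFun (R : ℕ) (x : ℝ) :
    HasDerivAt (truncEntropyFun R) (truncEntropyDeriv R x) x := by
  have h1 : HasDerivAt (truncNegLog R) (∑ k ∈ Finset.range R, -(1 - x) ^ k) x := by
    refine HasDerivAt.fun_sum fun k _ => ?_
    have := ((((hasDerivAt_id x).const_sub 1).pow (k + 1)).div_const ((k : ℝ) + 1))
    refine this.congr_deriv ?_
    have : (k : ℝ) + 1 ≠ 0 := by positivity
    simp
    field_simp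
  refine ((hasDerivAt_id x).mul h1).congr_deriv ?_
  have h2 := mul_neg_geom_sum (1 - x) R
  rw [sub_sub_cancel] at h2
  simp only [id, Finset.sum_neg_distrib, mul_neg, h2, truncEntropyDeriv]
  ring

theorem truncEntropyDeriv_antitoneOn (R : ℕ) :
    AntitoneOn (truncEntropyDeriv R) (Set.Iic 1) := by
  intro x hx y hy hxy
  have hy' : y ≤ 1 := hy
  have h1 := truncNegLog_antitoneOn R hx hy hxy
  have h2 : (1 - y) ^ R ≤ (1 - x) ^ R := by gcongr
  simp only [truncEntropyDeriv]
  linarith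

theorem neg_one_le_truncEntropyDeriv (R : ℕ) {x : ℝ} (hx : x ≤ 1) :
    -1 ≤ truncEntropyDeriv R x := by
  have h1 := truncNegLog_nonneg R hx
  have h2 : 0 ≤ (1 - x) ^ R := pow_nonneg (by linarith) _
  simp only [truncEntropyDeriv]
  linarith

theorem truncEntropyDeriv_le (R : ℕ) {x : ℝ} (hx0 : 0 ≤ x) (hx1 : x ≤ 1) :
    truncEntropyDeriv R x ≤ truncCoeff R 0 := by
  have h := truncEntropyDeriv_antitoneOn R (show (0 : ℝ) ∈ Set.Iic 1 by simp) hx1 hx0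
  simpa [truncEntropyDeriv, truncNegLog_zero] using h

/-- Concavity of the truncated entropy on `(-∞, 1]`: its graph lies below its tangents. -/
theorem truncEntropyFun_le_tangent (R : ℕ) {x y : ℝ} (hx : x ≤ 1) (hy : y ≤ 1) :
    truncEntropyFun R x ≤ truncEntropyFun R y + (x - y) * truncEntropyDeriv R y := by
  have hc : Continuous (truncEntropyFun R) :=
    continuous_iff_continuousAt.2 fun z => (hasDerivAt_truncEntropyFun R z).continuousAt
  rcases lt_trichotomy x y with h | rfl | h
  · obtain ⟨c, hc, hs⟩ := exists_hasDerivAt_eq_slope _ _ h hc.continuousOn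
      fun z _ => hasDerivAt_truncEntropyFun R z
    rw [eq_div_iff (by linarith)] at hs
    have := truncEntropyDeriv_antitoneOn R (show c ∈ Set.Iic 1 from hc.2.le.trans hy) hy hc.2.le
    nlinarith
  · simp
  · obtain ⟨c, hc, hs⟩ := exists_hasDerivAt_eq_slope _ _ h hc.continuousOn
      fun z _ => hasDerivAt_truncEntropyFun R z
    rw [eq_div_iff (by linarith)] at hs
    have := truncEntropyDeriv_antitoneOn R hy (show c ∈ Set.Iic 1 from hc.2.le.trans hx) hc.1.le
    nlinarith

/-- Term by term, `C_2 = ∑_{k=2}^R (k choose 2) / k` dominates `C_0 - 1 = ∑_{k=2}^R 1 / k`. -/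
theorem truncCoeff_two_bounds {R : ℕ} (hR : 2 ≤ R) :
    1 / 4 ≤ truncCoeff R 2 ∧ truncCoeff R 0 ≤ 1 + truncCoeff R 2 := by
  have h2 : truncCoeff R 2 = ∑ k ∈ Finset.Icc 2 R, (k.choose 2 : ℝ) / k := by
    simp [truncCoeff]
  constructor
  · -- the summand `k = 2` is `1 / 2`
    rw [h2]
    refine le_trans ?_ (Finset.single_le_sum (f := fun k : ℕ => (k.choose 2 : ℝ) / k)
      (fun k _ => by positivity) (Finset.mem_Icc.2 ⟨le_rfl, hR⟩))
    norm_num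
  · have h0 : truncCoeff R 0 = 1 + ∑ k ∈ Finset.Icc 2 R, 1 / (k : ℝ) := by
      simp only [truncCoeff, if_true]
      rw [← Finset.add_sum_Ioc_eq_sum_Icc (by omega : 1 ≤ R)]
      simp
      rfl
    rw [h0, h2]
    gcongr with k hk
    exact_mod_cast Nat.choose_pos (Finset.mem_Icc.1 hk).1

/-- Turns a bound on the relative entropy `D` into the bound on the fidelity: if `y` is the square
root on the left, then `D ≤ 2 * y + y ^ 2`, and `1 - y ≤ exp (-y - y ^ 2 / 2)`. -/
theorem one_sub_sqrt_le_exp {a b C C₀ δ D : ℝ} (ha : 0 ≤ a) (hab : a ≤ b) (hC : 1 / 4 ≤ C)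
    (hC₀ : C₀ ≤ 1 + C) (hδ0 : 0 ≤ δ) (hδ1 : δ < 1) (hD : D ≤ a + (C₀ + 1) * δ) :
    1 - √(2 * b + C * δ / (1 - δ)) ≤ Real.exp (-D / 2) := by
  set y := √(2 * b + C * δ / (1 - δ)) with hy
  have hδ' : 0 < 1 - δ := by linarith
  have hu0 : 0 ≤ C * δ / (1 - δ) := by positivity
  have hy0 : 0 ≤ y := Real.sqrt_nonneg _
  have hy2 : y ^ 2 = 2 * b + C * δ / (1 - δ) := Real.sq_sqrt (by linarith)
  have hu : C * δ ≤ C * δ / (1 - δ) := le_div_self (by positivity) hδ' (by linarith)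
  -- `δ ^ 2 ≤ C * δ / (1 - δ)` because `δ * (1 - δ) ≤ 1 / 4 ≤ C`
  have hδy : δ ≤ y := by
    refine Real.le_sqrt_of_sq_le (le_trans ?_ (le_add_of_nonneg_left (by linarith)))
    rw [le_div_iff₀ hδ']
    nlinarith [sq_nonneg (δ - 1 / 2)]
  -- `(C₀ + 1) * δ ≤ 2 * δ + C * δ`, where `δ ≤ y` and `C * δ ≤ y ^ 2 - 2 * b`
  have hDy : D ≤ 2 * y + y ^ 2 := by nlinarith
  rcases le_or_gt 1 y with h1 | h1
  · exact le_trans (by linarith) (Real.exp_pos _).le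
  · have hlog : truncNegLog 2 (1 - y) ≤ -Real.log (1 - y) :=
      truncNegLog_le_neg_log 2 (by linarith) (by linarith)
    rw [← Real.log_le_iff_le_exp (by linarith)]
    norm_num [truncNegLog, Finset.sum_range_succ] at hlog
    linarith

/-! ### Matrices with a prescribed spectral decomposition -/

section Spectral

variable {ι : Type*} [Fintype ι] [DecidableEq ι]

/-- The Hermitian matrix `B * diagonal l * Bᴴ`, with the columns of the unitary `B` as eigenvectors
and the reals `l i` as eigenvalues. -/
noncomputable def ofSpectrum (B : Matrix.unitaryGroup ι ℂ) (l : ι → ℝ) : Matrix ι ι ℂ :=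
  Unitary.conjStarAlgAut ℂ (Matrix ι ι ℂ) B (Matrix.diagonal fun i => (l i : ℂ))

theorem ofSpectrum_eq (B : Matrix.unitaryGroup ι ℂ) (l : ι → ℝ) :
    ofSpectrum B l = B.1 * Matrix.diagonal (fun i => (l i : ℂ)) * B.1ᴴ := by
  rw [ofSpectrum, Unitary.conjStarAlgAut_apply]
  rfl

theorem conjTranspose_mul_coe (B : Matrix.unitaryGroup ι ℂ) : B.1ᴴ * B.1 = 1 :=
  Matrix.mem_unitaryGroup_iff'.1 B.2

theorem coe_mul_conjTranspose (B : Matrix.unitaryGroup ι ℂ) : B.1 * B.1ᴴ = 1 :=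
  Matrix.mem_unitaryGroup_iff.1 B.2

theorem conj_ofSpectrum (B : Matrix.unitaryGroup ι ℂ) (l : ι → ℝ) :
    B.1ᴴ * ofSpectrum B l * B.1 = Matrix.diagonal fun i => (l i : ℂ) := by
  rw [ofSpectrum_eq, ← Matrix.mul_assoc, ← Matrix.mul_assoc, conjTranspose_mul_coe, Matrix.one_mul,
    Matrix.mul_assoc, conjTranspose_mul_coe, Matrix.mul_one]

theorem eq_ofSpectrum {A : Matrix ι ι ℂ} (hA : A.IsHermitian) :
    A = ofSpectrum hA.eigenvectorUnitary hA.eigenvalues :=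
  hA.spectral_theorem

theorem isHermitian_ofSpectrum (B : Matrix.unitaryGroup ι ℂ) (l : ι → ℝ) :
    (ofSpectrum B l).IsHermitian := by
  rw [ofSpectrum_eq]
  refine Matrix.isHermitian_mul_mul_conjTranspose _ ?_
  ext i j
  by_cases h : i = j
  · simp [h]
  · simp [h, Ne.symm h]

theorem ofSpectrum_mul (B : Matrix.unitaryGroup ι ℂ) (l m : ι → ℝ) :
    ofSpectrum B l * ofSpectrum B m = ofSpectrum B (l * m) := by
  simp only [ofSpectrum, ← map_mul, Matrix.diagonal_mul_diagonal, Pi.mul_apply, Complex.ofReal_mul]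

theorem trace_ofSpectrum (B : Matrix.unitaryGroup ι ℂ) (l : ι → ℝ) :
    (ofSpectrum B l).trace = ((∑ i, l i : ℝ) : ℂ) := by
  rw [ofSpectrum_eq, Matrix.trace_mul_comm, ← Matrix.mul_assoc, conjTranspose_mul_coe,
    Matrix.one_mul, Matrix.trace_diagonal, Complex.ofReal_sum]

theorem smul_ofSpectrum (B : Matrix.unitaryGroup ι ℂ) (c : ℝ) (l : ι → ℝ) :
    (c : ℂ) • ofSpectrum B l = ofSpectrum B fun i => c * l i := by
  rw [ofSpectrum, ofSpectrum, ← map_smul, ← Matrix.diagonal_smul]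
  congr 2
  ext i
  simp

/-- The functional calculus acts on the eigenvalues of any unitary diagonalization. On the finite
spectrum the function can be replaced by an interpolating polynomial, which passes through the
conjugation. -/
theorem cfc_ofSpectrum (B : Matrix.unitaryGroup ι ℂ) (l : ι → ℝ) (f : ℝ → ℝ) :
    cfc f (ofSpectrum B l) = ofSpectrum B fun i => f (l i) := by
  obtain ⟨p, hp⟩ : ∃ p : Polynomial ℝ, ∀ i, p.eval (l i) = f (l i) :=
    ⟨Lagrange.interpolate (Finset.univ.image l) id f, fun i =>
      Lagrange.eval_interpolate_at_node (v := id) f (Set.injOn_id _)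
        (Finset.mem_image_of_mem l (Finset.mem_univ i))⟩
  have hs : ∀ x ∈ spectrum ℝ (ofSpectrum B l), ∃ i, l i = x := by
    intro x hx
    have hx' := spectrum.algebraMap_mem ℂ hx
    rw [ofSpectrum, Unitary.conjStarAlgAut_apply, Unitary.spectrum_star_right_conjugate,
      spectrum_diagonal] at hx'
    obtain ⟨i, hi⟩ := hx'
    exact ⟨i, by simpa using hi⟩
  have hcongr : cfc f (ofSpectrum B l) = cfc p.eval (ofSpectrum B l) := by
    refine cfc_congr fun x hx => ?_
    obtain ⟨i, rfl⟩ := hs x hx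
    exact (hp i).symm
  rw [hcongr, cfc_polynomial p _ (isHermitian_ofSpectrum B l).isSelfAdjoint]
  let φ : (ι → ℂ) →ₐ[ℝ] Matrix ι ι ℂ :=
    (((Unitary.conjStarAlgAut ℂ (Matrix ι ι ℂ) B).toAlgEquiv.toAlgHom).restrictScalars ℝ).comp
      (Matrix.diagonalAlgHom ℝ)
  have h := Polynomial.aeval_algHom_apply φ (fun i => (l i : ℂ)) p
  have h2 : Polynomial.aeval (fun i => (l i : ℂ)) p = fun i => ((f (l i) : ℝ) : ℂ) := by
    ext i
    have h3 := Polynomial.aeval_algHom_apply (Pi.evalAlgHom ℝ (fun _ : ι => ℂ) i)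
      (fun i => (l i : ℂ)) p
    rw [← hp i]
    refine h3.symm.trans ?_
    exact Polynomial.aeval_algebraMap_apply ℂ (l i) p
  rw [h2] at h
  exact h

theorem exp_ofSpectrum (B : Matrix.unitaryGroup ι ℂ) (l : ι → ℝ) :
    NormedSpace.exp (ofSpectrum B l) = ofSpectrum B fun i => Real.exp (l i) := by
  have hB : IsUnit B.1 := ⟨Unitary.toUnits B, rfl⟩
  have hinv : B.1⁻¹ = B.1ᴴ := Matrix.inv_eq_right_inv (coe_mul_conjTranspose B)
  rw [ofSpectrum_eq, ofSpectrum_eq, ← hinv, Matrix.exp_conj _ _ hB, Matrix.exp_diagonal]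
  congr 3
  ext i
  rw [Pi.coe_exp, ← Complex.exp_eq_exp_ℂ, Complex.ofReal_exp]

/-- The squared modulus of the inner product of the `i`-th column of `A` with the `j`-th column of
`B`. -/
noncomputable def overlap (A B : Matrix.unitaryGroup ι ℂ) (i j : ι) : ℝ :=
  Complex.normSq ((A.1ᴴ * B.1) i j)

theorem overlap_nonneg (A B : Matrix.unitaryGroup ι ℂ) (i j : ι) : 0 ≤ overlap A B i j :=
  Complex.normSq_nonneg _

theorem trace_ofSpectrum_mul_ofSpectrum (A B : Matrix.unitaryGroup ι ℂ) (p q : ι → ℝ) :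
    (ofSpectrum A p * ofSpectrum B q).trace =
      ((∑ i, ∑ j, overlap A B i j * (p i * q j) : ℝ) : ℂ) := by
  have h : (ofSpectrum A p * ofSpectrum B q).trace =
      (Matrix.diagonal (fun i => (p i : ℂ)) * ((A.1ᴴ * B.1) *
        Matrix.diagonal (fun i => (q i : ℂ)) * (A.1ᴴ * B.1)ᴴ)).trace := by
    rw [ofSpectrum_eq, ofSpectrum_eq, Matrix.mul_assoc, Matrix.mul_assoc, Matrix.trace_mul_comm]
    simp only [Matrix.conjTranspose_mul, Matrix.conjTranspose_conjTranspose, Matrix.mul_assoc]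
  rw [h, Matrix.trace, Complex.ofReal_sum]
  refine Finset.sum_congr rfl fun i _ => ?_
  rw [Matrix.diag_apply, Matrix.diagonal_mul, Matrix.mul_apply, Complex.ofReal_sum, Finset.mul_sum]
  refine Finset.sum_congr rfl fun j _ => ?_
  rw [Matrix.mul_diagonal, Matrix.conjTranspose_apply, overlap, Complex.ofReal_mul,
    Complex.normSq_eq_conj_mul_self, Complex.ofReal_mul, starRingEnd_apply]
  ring

theorem sum_normSq_row {m n : Type*} [Fintype n] [DecidableEq m] {G : Matrix m n ℂ}
    (hG : G * Gᴴ = 1) (i : m) : ∑ j, Complex.normSq (G i j) = 1 := by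
  have h := congrFun (congrFun hG i) i
  rw [Matrix.mul_apply, Matrix.one_apply_eq] at h
  rw [← Complex.ofReal_inj, Complex.ofReal_sum, Complex.ofReal_one, ← h]
  refine Finset.sum_congr rfl fun j _ => ?_
  rw [Matrix.conjTranspose_apply, Complex.normSq_eq_conj_mul_self, mul_comm, starRingEnd_apply]

theorem sum_overlap_right (A B : Matrix.unitaryGroup ι ℂ) (i : ι) : ∑ j, overlap A B i j = 1 := by
  refine sum_normSq_row ?_ i
  rw [Matrix.conjTranspose_mul, Matrix.conjTranspose_conjTranspose, Matrix.mul_assoc,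
    ← Matrix.mul_assoc B.1, coe_mul_conjTranspose, Matrix.one_mul, conjTranspose_mul_coe]

/-! ### Fidelity and relative entropy -/

/-- The trace norm of `A`, that is `Tr √(Aᴴ A)`, dominates `Re (Tr A)`: in an eigenbasis of `Aᴴ A`
each diagonal entry of `A` is at most the norm of its column. -/
theorem trace_re_le_trace_matSqrt (A : Matrix ι ι ℂ) :
    A.trace.re ≤ (matSqrt (Aᴴ * A)).trace.re := by
  have hM : (Aᴴ * A).IsHermitian := Matrix.isHermitian_conjTranspose_mul_self A
  set V := hM.eigenvectorUnitary
  set l := hM.eigenvalues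
  have hMl : Aᴴ * A = ofSpectrum V l := eq_ofSpectrum hM
  set B := V.1ᴴ * A * V.1 with hB
  have hBB : Bᴴ * B = Matrix.diagonal fun i => (l i : ℂ) := by
    rw [← conj_ofSpectrum V l, ← hMl, hB]
    simp only [Matrix.conjTranspose_mul, Matrix.conjTranspose_conjTranspose, Matrix.mul_assoc]
    rw [← Matrix.mul_assoc V.1 V.1ᴴ, coe_mul_conjTranspose, Matrix.one_mul]
  have htr : A.trace = B.trace := by
    rw [hB, Matrix.trace_mul_comm, ← Matrix.mul_assoc, coe_mul_conjTranspose, Matrix.one_mul]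
  rw [htr, matSqrt, hMl, cfc_ofSpectrum, trace_ofSpectrum, Complex.ofReal_re, Matrix.trace,
    Complex.re_sum]
  refine Finset.sum_le_sum fun i _ => (Complex.re_le_norm _).trans (Real.le_sqrt_of_sq_le ?_)
  have h : (∑ k, Complex.normSq (B k i)) = l i := by
    have h := congrFun (congrFun hBB i) i
    rw [Matrix.mul_apply, Matrix.diagonal_apply_eq] at h
    rw [← Complex.ofReal_inj, Complex.ofReal_sum, ← h]
    refine Finset.sum_congr rfl fun j _ => ?_
    rw [Matrix.conjTranspose_apply, Complex.normSq_eq_conj_mul_self, starRingEnd_apply]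
  rw [← h, ← Complex.normSq_eq_norm_sq]
  exact Finset.single_le_sum (f := fun k => Complex.normSq (B k i))
    (fun k _ => Complex.normSq_nonneg _) (Finset.mem_univ i)

theorem sum_sqrt_le_fidelity (A B : Matrix.unitaryGroup ι ℂ) {p q : ι → ℝ} (hp : ∀ i, 0 ≤ p i) :
    ∑ i, ∑ j, overlap A B i j * (√(p i) * √(q j)) ≤
      fidelity (ofSpectrum B q) (ofSpectrum A p) := by
  have h := trace_re_le_trace_matSqrt
    (ofSpectrum A (fun i => √(p i)) * ofSpectrum B fun j => √(q j))
  rw [trace_ofSpectrum_mul_ofSpectrum, Complex.ofReal_re, Matrix.conjTranspose_mul,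
    (isHermitian_ofSpectrum _ _).eq, (isHermitian_ofSpectrum _ _).eq] at h
  have hsq : ofSpectrum A p =
      ofSpectrum A (fun i => √(p i)) * ofSpectrum A fun i => √(p i) := by
    rw [ofSpectrum_mul]
    congr 1
    ext i
    simp [Real.mul_self_sqrt (hp i)]
  rw [fidelity, matSqrt, matSqrt, cfc_ofSpectrum B, hsq]
  simpa only [Matrix.mul_assoc, matSqrt] using h

/-- The relative entropy `D` of the states with spectra `p` and `q` equals that of the two
classical distributions `overlap i j * p i` and `overlap i j * q j`. For these,
`exp (-D / 2) ≤ ∑ √(P Q)` is Jensen's inequality for the exponential. -/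
theorem exp_neg_relEntropy_le_sum_sqrt (A B : Matrix.unitaryGroup ι ℂ) {p q : ι → ℝ}
    (hp : ∀ i, 0 ≤ p i) (hp1 : ∑ i, p i = 1) (hq : ∀ j, 0 < q j) :
    Real.exp (-(∑ i, ∑ j, overlap A B i j * (p i * (Real.log (p i) - Real.log (q j)))) / 2) ≤
      ∑ i, ∑ j, overlap A B i j * (√(p i) * √(q j)) := by
  have h := convexOn_exp.map_sum_le (t := (Finset.univ : Finset (ι × ι)))
    (w := fun x => overlap A B x.1 x.2 * p x.1)
    (p := fun x => (Real.log (q x.2) - Real.log (p x.1)) / 2)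
    (fun x _ => mul_nonneg (overlap_nonneg _ _ _ _) (hp _))
    (by simp only [Fintype.sum_prod_type, ← Finset.sum_mul, sum_overlap_right, one_mul, hp1])
    (fun _ _ => Set.mem_univ _)
  simp only [Fintype.sum_prod_type, smul_eq_mul] at h
  refine (le_of_eq ?_).trans (h.trans (le_of_eq ?_))
  · congr 1
    rw [← Finset.sum_neg_distrib, Finset.sum_div]
    refine Finset.sum_congr rfl fun i _ => ?_
    rw [← Finset.sum_neg_distrib, Finset.sum_div]
    exact Finset.sum_congr rfl fun j _ => by ring
  · refine Finset.sum_congr rfl fun i _ => Finset.sum_congr rfl fun j _ => ?_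
    rcases (hp i).eq_or_lt with h0 | h0
    · simp [← h0]
    · rw [mul_assoc, sub_div, Real.exp_sub, Real.exp_half, Real.exp_half, Real.exp_log h0,
        Real.exp_log (hq j)]
      have hs : √(p i) ≠ 0 := (Real.sqrt_pos.2 h0).ne'
      nth_rewrite 1 [← Real.mul_self_sqrt h0.le]
      field_simp

theorem vonNeumannEntropy_ofSpectrum (A : Matrix.unitaryGroup ι ℂ) (p : ι → ℝ) :
    vonNeumannEntropy (ofSpectrum A p) = -∑ i, p i * Real.log (p i) := by
  rw [vonNeumannEntropy, cfc_ofSpectrum, ofSpectrum_mul, trace_ofSpectrum, Complex.ofReal_re]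
  rfl

/-- The fidelity with the Gibbs state is bounded below through the excess free energy, which is
`β⁻¹` times the relative entropy to the Gibbs state. -/
theorem exp_neg_freeEnergy_sub_le_fidelity {H : Matrix ι ι ℂ} (hH : H.IsHermitian) {β : ℝ}
    (hβ : 0 < β) {ρ : Matrix ι ι ℂ} (hρ : IsDensityMatrix ρ) :
    Real.exp (-(β * (freeEnergy β H ρ - freeEnergy β H (gibbsState β H))) / 2) ≤
      fidelity (gibbsState β H) ρ := by
  obtain ⟨B, e, rfl⟩ : ∃ B e, H = ofSpectrum B e := ⟨_, _, eq_ofSpectrum hH⟩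
  have hA := eq_ofSpectrum hρ.1.isHermitian
  set A := hρ.1.isHermitian.eigenvectorUnitary
  set p := hρ.1.isHermitian.eigenvalues
  have hp : ∀ i, 0 ≤ p i := hρ.1.eigenvalues_nonneg
  have hp1 : ∑ i, p i = 1 := by
    have h := hρ.2
    rw [hA, trace_ofSpectrum] at h
    exact_mod_cast h
  have hne : Nonempty ι := by
    by_contra hne
    rw [not_nonempty_iff] at hne
    simp at hp1
  set Z := ∑ j, Real.exp (-β * e j) with hZ
  have hZ0 : 0 < Z := Finset.sum_pos (fun j _ => Real.exp_pos _) Finset.univ_nonempty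
  have hgibbs : gibbsState β (ofSpectrum B e) =
      ofSpectrum B fun j => Z⁻¹ * Real.exp (-β * e j) := by
    rw [gibbsState, ← Complex.ofReal_neg, smul_ofSpectrum, exp_ofSpectrum, trace_ofSpectrum,
      ← Complex.ofReal_inv, smul_ofSpectrum]
  set q : ι → ℝ := fun j => Z⁻¹ * Real.exp (-β * e j) with hq
  have hq0 : ∀ j, 0 < q j := fun j => mul_pos (inv_pos.2 hZ0) (Real.exp_pos _)
  have hq1 : ∑ j, q j = 1 := by
    rw [hq, ← Finset.mul_sum, ← hZ, inv_mul_cancel₀ hZ0.ne']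
  have hlog : ∀ j, Real.log (q j) = -Real.log Z - β * e j := fun j => by
    rw [hq, Real.log_mul (inv_pos.2 hZ0).ne' (Real.exp_pos _).ne', Real.log_inv, Real.log_exp]
    ring
  have hFG : β * freeEnergy β (ofSpectrum B e) (gibbsState β (ofSpectrum B e)) = -Real.log Z := by
    rw [hgibbs, freeEnergy, vonNeumannEntropy_ofSpectrum, ofSpectrum_mul, trace_ofSpectrum,
      Complex.ofReal_re, mul_sub, mul_inv_cancel_left₀ hβ.ne', sub_neg_eq_add, Finset.mul_sum,
      ← Finset.sum_add_distrib]
    calc ∑ j, (β * (e * q) j + q j * Real.log (q j)) = ∑ j, q j * -Real.log Z :=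
          Finset.sum_congr rfl fun j _ => by rw [hlog, Pi.mul_apply]; ring
      _ = -Real.log Z := by rw [← Finset.sum_mul, hq1, one_mul]
  have hF : β * freeEnergy β (ofSpectrum B e) (ofSpectrum A p) =
      (∑ i, ∑ j, overlap A B i j * (p i * (β * e j))) + ∑ i, p i * Real.log (p i) := by
    rw [freeEnergy, vonNeumannEntropy_ofSpectrum, Matrix.trace_mul_comm,
      trace_ofSpectrum_mul_ofSpectrum, Complex.ofReal_re, mul_sub, mul_inv_cancel_left₀ hβ.ne',
      sub_neg_eq_add, Finset.mul_sum]
    congr 1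
    refine Finset.sum_congr rfl fun i _ => ?_
    rw [Finset.mul_sum]
    exact Finset.sum_congr rfl fun j _ => by ring
  have hD : β * (freeEnergy β (ofSpectrum B e) ρ -
      freeEnergy β (ofSpectrum B e) (gibbsState β (ofSpectrum B e))) =
      ∑ i, ∑ j, overlap A B i j * (p i * (Real.log (p i) - Real.log (q j))) := by
    rw [mul_sub, hFG, hA, hF]
    have h1 : ∀ i j, overlap A B i j * (p i * (Real.log (p i) - Real.log (q j))) =
        overlap A B i j * (p i * (β * e j)) +
          overlap A B i j * (p i * Real.log (p i) + p i * Real.log Z) := fun i j => by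
      rw [hlog]
      ring
    simp only [h1, Finset.sum_add_distrib, ← Finset.sum_mul, sum_overlap_right, one_mul, hp1]
    ring
  rw [hD]
  refine (exp_neg_relEntropy_le_sum_sqrt A B hp hp1 hq0).trans ?_
  rw [hgibbs, hA]
  exact sum_sqrt_le_fidelity A B hp

end Spectral

/-! ### Compressions and the truncated entropy -/

/-- Bessel's inequality: if `X * Xᴴ * X = X` then `X * Xᴴ` is an orthogonal projection, whose
diagonal entries are at most `1`. -/
theorem sum_normSq_row_le_one {m n : Type*} [Fintype m] [Fintype n] {X : Matrix m n ℂ}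
    (hX : X * Xᴴ * X = X) (j : m) : ∑ i, Complex.normSq (X j i) ≤ 1 := by
  set s := ∑ i, Complex.normSq (X j i) with hs
  have hP : (X * Xᴴ) j j = (s : ℂ) := by
    rw [Matrix.mul_apply, hs, Complex.ofReal_sum]
    refine Finset.sum_congr rfl fun i _ => ?_
    rw [Matrix.conjTranspose_apply, Complex.normSq_eq_conj_mul_self, mul_comm, starRingEnd_apply]
  have hPH : (X * Xᴴ)ᴴ = X * Xᴴ := by
    rw [Matrix.conjTranspose_mul, Matrix.conjTranspose_conjTranspose]
  have hPP : X * Xᴴ * (X * Xᴴ)ᴴ = X * Xᴴ := by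
    rw [hPH, ← Matrix.mul_assoc, hX]
  have h := congrFun (congrFun hPP j) j
  rw [Matrix.mul_apply] at h
  have h' : ∑ l, Complex.normSq ((X * Xᴴ) j l) = s := by
    rw [← Complex.ofReal_inj, Complex.ofReal_sum, ← hP, ← h]
    refine Finset.sum_congr rfl fun i _ => ?_
    rw [Matrix.conjTranspose_apply (X * Xᴴ), Complex.normSq_eq_conj_mul_self, mul_comm,
      starRingEnd_apply]
  have h2 : s * s ≤ s := by
    calc s * s = Complex.normSq ((X * Xᴴ) j j) := by rw [hP, Complex.normSq_ofReal]
      _ ≤ ∑ l, Complex.normSq ((X * Xᴴ) j l) := Finset.single_le_sum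
          (f := fun l => Complex.normSq ((X * Xᴴ) j l))
          (fun k _ => Complex.normSq_nonneg _) (Finset.mem_univ j)
      _ = s := h'
  nlinarith

theorem le_one_of_sum_eq_one {ι : Type*} [Fintype ι] {p : ι → ℝ} (hp : ∀ i, 0 ≤ p i)
    (hp1 : ∑ i, p i = 1) (i : ι) : p i ≤ 1 :=
  hp1 ▸ Finset.single_le_sum (fun i _ => hp i) (Finset.mem_univ i)

/-- Klein's inequality for a compression. Compressing the state `diagonal l` by the isometry `G` and
renormalizing gives the state `diagonal μ`. The weight `δ` lost in the compression is nonnegative,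
and the truncated entropy increases by at most `(C_0 + 1) * δ`.

The weights are `W j i = |⟨j, ψ i⟩|²`, where `ψ i` is the normalized vector `√(diagonal l) * G i`.
As the `ψ i` are orthonormal, the tangent inequality for the truncated entropy at `l j`, averaged
with these weights, compares the two entropies. -/
theorem sum_truncEntropyFun_le_of_compression {m n : Type*} [Fintype m] [Fintype n] [DecidableEq m]
    [DecidableEq n] (R : ℕ) {G : Matrix m n ℂ} (hG : Gᴴ * G = 1) {l : m → ℝ} {μ : n → ℝ} {δ : ℝ}
    (hl : ∀ j, 0 ≤ l j) (hl1 : ∑ j, l j = 1) (hμ : ∀ i, 0 ≤ μ i) (hμ1 : ∑ i, μ i = 1)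
    (hδ1 : δ < 1)
    (hc : Gᴴ * Matrix.diagonal (fun j => (l j : ℂ)) * G =
      Matrix.diagonal fun i => (((1 - δ) * μ i : ℝ) : ℂ)) :
    0 ≤ δ ∧
    ∑ i, truncEntropyFun R (μ i) ≤ ∑ j, truncEntropyFun R (l j) + (truncCoeff R 0 + 1) * δ := by
  set f := truncEntropyFun R with hf
  set f' := truncEntropyDeriv R with hf'
  set a : n → ℝ := fun i => (1 - δ) * μ i with ha
  have hδ' : 0 < 1 - δ := by linarith
  have ha0 : ∀ i, 0 ≤ a i := fun i => mul_nonneg hδ'.le (hμ i)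
  have hl_le : ∀ j, l j ≤ 1 := le_one_of_sum_eq_one hl hl1
  have hμ_le : ∀ i, μ i ≤ 1 := le_one_of_sum_eq_one hμ hμ1
  have hf0 : f 0 = 0 := by simp [hf, truncEntropyFun]
  set w : m → n → ℝ := fun j i => Complex.normSq (G j i) with hw
  have hw0 : ∀ j i, 0 ≤ w j i := fun j i => Complex.normSq_nonneg _
  have hcol : ∀ i, ∑ j, l j * w j i = a i := fun i => by
    have h := congrFun (congrFun hc i) i
    rw [Matrix.mul_apply, Matrix.diagonal_apply_eq] at h
    rw [← Complex.ofReal_inj, Complex.ofReal_sum, ← h]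
    refine Finset.sum_congr rfl fun j _ => ?_
    rw [Matrix.mul_diagonal, Matrix.conjTranspose_apply, Complex.ofReal_mul,
      Complex.normSq_eq_conj_mul_self, starRingEnd_apply]
    ring
  have hM : ∀ j, ∑ i, w j i ≤ 1 :=
    sum_normSq_row_le_one (by rw [Matrix.mul_assoc, hG, Matrix.mul_one])
  have htot : ∑ j, l j * ∑ i, w j i = 1 - δ := by
    calc ∑ j, l j * ∑ i, w j i = ∑ i, ∑ j, l j * w j i := by
          simp only [Finset.mul_sum]
          exact Finset.sum_comm
      _ = 1 - δ := by
          rw [Finset.sum_congr rfl fun i _ => hcol i, ha, ← Finset.mul_sum, hμ1, mul_one]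
  have hδ0 : 0 ≤ δ := by
    have h : ∑ j, l j * ∑ i, w j i ≤ ∑ j, l j :=
      Finset.sum_le_sum fun j _ => mul_le_of_le_one_right (hl j) (hM j)
    linarith
  -- the `i`-th column of `X` is `ψ i`; if `a i = 0` it is zero, since `0⁻¹ = 0`
  set X : Matrix m n ℂ := Matrix.diagonal (fun j => ((√(l j) : ℝ) : ℂ)) * G *
    Matrix.diagonal (fun i => (((√(a i))⁻¹ : ℝ) : ℂ)) with hXdef
  have hXn : ∀ j i, Complex.normSq (X j i) = l j * w j i / a i := fun j i => by
    rw [hXdef, Matrix.mul_diagonal, Matrix.diagonal_mul, Complex.normSq_mul, Complex.normSq_mul,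
      Complex.normSq_ofReal, Complex.normSq_ofReal, Real.mul_self_sqrt (hl j), ← mul_inv,
      Real.mul_self_sqrt (ha0 i), div_eq_mul_inv]
  have hW : ∀ j, ∑ i, l j * w j i / a i ≤ 1 := by
    have hsq : Matrix.diagonal (fun j => ((√(l j) : ℝ) : ℂ)) *
        Matrix.diagonal (fun j => ((√(l j) : ℝ) : ℂ)) = Matrix.diagonal fun j => (l j : ℂ) := by
      rw [Matrix.diagonal_mul_diagonal]
      congr 1
      ext j
      rw [← Complex.ofReal_mul, Real.mul_self_sqrt (hl j)]
    have hXX : Xᴴ * X = Matrix.diagonal fun i => (((√(a i))⁻¹ * a i * (√(a i))⁻¹ : ℝ) : ℂ) := by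
      have hXH : Xᴴ = Matrix.diagonal (fun i => (((√(a i))⁻¹ : ℝ) : ℂ)) *
          (Gᴴ * Matrix.diagonal (fun j => ((√(l j) : ℝ) : ℂ))) := by
        rw [hXdef, Matrix.conjTranspose_mul, Matrix.conjTranspose_mul]
        congr 1
        · rw [Matrix.diagonal_conjTranspose]
          congr 1
          ext i
          simp
        · congr 1
          rw [Matrix.diagonal_conjTranspose]
          congr 1
          ext i
          simp
      calc Xᴴ * X = Matrix.diagonal (fun i => (((√(a i))⁻¹ : ℝ) : ℂ)) *
            (Gᴴ * (Matrix.diagonal (fun j => ((√(l j) : ℝ) : ℂ)) *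
              Matrix.diagonal (fun j => ((√(l j) : ℝ) : ℂ))) * G) *
            Matrix.diagonal (fun i => (((√(a i))⁻¹ : ℝ) : ℂ)) := by
              rw [hXH, hXdef]
              simp only [Matrix.mul_assoc]
        _ = _ := by
              rw [hsq, hc, Matrix.diagonal_mul_diagonal, Matrix.diagonal_mul_diagonal]
              simp only [Complex.ofReal_mul, ha]
    have hX : X * Xᴴ * X = X := by
      rw [Matrix.mul_assoc, hXX]
      ext j i
      rw [Matrix.mul_diagonal, hXdef, Matrix.mul_diagonal, mul_assoc, ← Complex.ofReal_mul]
      congr 2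
      rcases (ha0 i).eq_or_lt with h | h
      · simp [← h]
      · have hs : √(a i) ≠ 0 := (Real.sqrt_pos.2 h).ne'
        nth_rewrite 3 [← Real.mul_self_sqrt h.le]
        field_simp
    intro j
    simpa only [hXn] using sum_normSq_row_le_one hX j
  have hg0 : ∀ j, 0 ≤ f (l j) - l j * f' (l j) := fun j => by
    have h := truncEntropyFun_le_tangent R zero_le_one (hl_le j)
    rw [← hf, hf0] at h
    linarith
  have hcolumn : ∀ i, f (μ i) ≤ ∑ j, l j * w j i / a i * (f (l j) - l j * f' (l j)) +
      ∑ j, l j * w j i / (1 - δ) * f' (l j) := fun i => by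
    rcases (hμ i).eq_or_lt with h | h
    · have ha' : a i = 0 := by simp [ha, ← h]
      have hz : ∀ j, l j * w j i = 0 := fun j =>
        (Finset.sum_eq_zero_iff_of_nonneg fun j _ => mul_nonneg (hl j) (hw0 j i)).1
          ((hcol i).trans ha') j (Finset.mem_univ j)
      simp [← h, hf0, hz]
    · have ha' : 0 < a i := mul_pos hδ' h
      calc f (μ i) = ∑ j, l j * w j i / a i * f (μ i) := by
            rw [← Finset.sum_mul, ← Finset.sum_div, hcol, div_self ha'.ne', one_mul]
        _ ≤ ∑ j, l j * w j i / a i * (f (l j) + (μ i - l j) * f' (l j)) :=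
            Finset.sum_le_sum fun j _ => mul_le_mul_of_nonneg_left
              (truncEntropyFun_le_tangent R (hμ_le i) (hl_le j))
              (div_nonneg (mul_nonneg (hl j) (hw0 j i)) ha'.le)
        _ = _ := by
            rw [← Finset.sum_add_distrib]
            refine Finset.sum_congr rfl fun j _ => ?_
            have hm : l j * w j i / (1 - δ) = l j * w j i / a i * μ i := by
              rw [ha]
              field_simp
            rw [hm]
            ring
  -- the second summand on the right sums to zero over `j`; it serves to replace `f'` by `f' + 1 ≥ 0`
  have hrow : ∀ j, (∑ i, l j * w j i / a i) * (f (l j) - l j * f' (l j)) +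
      (∑ i, l j * w j i / (1 - δ)) * f' (l j) ≤
      f (l j) + (l j - l j * (∑ i, w j i) / (1 - δ)) +
        (truncCoeff R 0 + 1) * (δ / (1 - δ)) * (l j * ∑ i, w j i) := fun j => by
    have h1 := mul_le_mul_of_nonneg_right (hW j) (hg0 j)
    have hlo := neg_one_le_truncEntropyDeriv R (hl_le j)
    have hhi := truncEntropyDeriv_le R (hl j) (hl_le j)
    rw [← hf'] at hlo hhi
    rw [← Finset.sum_div, ← Finset.mul_sum]
    set M := ∑ i, w j i
    have hM0 : 0 ≤ M := Finset.sum_nonneg fun i _ => hw0 j i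
    have hMd : M / (1 - δ) - 1 ≤ δ / (1 - δ) * M := by
      have : M / (1 - δ) - δ / (1 - δ) * M = M := by
        field_simp
      linarith [hM j]
    have h2 : (f' (l j) + 1) * (M / (1 - δ) - 1) ≤
        (truncCoeff R 0 + 1) * (δ / (1 - δ) * M) :=
      (mul_le_mul_of_nonneg_left hMd (by linarith)).trans
        (mul_le_mul_of_nonneg_right (by linarith)
          (mul_nonneg (div_nonneg hδ0 hδ'.le) hM0))
    have h3 := mul_le_mul_of_nonneg_left h2 (hl j)
    have h4 : l j * M / (1 - δ) = l j * (M / (1 - δ)) := mul_div_assoc _ _ _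
    rw [h4]
    linarith
  refine ⟨hδ0, ?_⟩
  calc ∑ i, f (μ i) ≤ ∑ i, (∑ j, l j * w j i / a i * (f (l j) - l j * f' (l j)) +
        ∑ j, l j * w j i / (1 - δ) * f' (l j)) := Finset.sum_le_sum fun i _ => hcolumn i
    _ = ∑ j, ((∑ i, l j * w j i / a i) * (f (l j) - l j * f' (l j)) +
        (∑ i, l j * w j i / (1 - δ)) * f' (l j)) := by
          simp only [Finset.sum_mul, ← Finset.sum_add_distrib]
          exact Finset.sum_comm
    _ ≤ ∑ j, (f (l j) + (l j - l j * (∑ i, w j i) / (1 - δ)) +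
        (truncCoeff R 0 + 1) * (δ / (1 - δ)) * (l j * ∑ i, w j i)) :=
          Finset.sum_le_sum fun j _ => hrow j
    _ = ∑ j, f (l j) + (truncCoeff R 0 + 1) * δ := by
          rw [Finset.sum_add_distrib, Finset.sum_add_distrib, Finset.sum_sub_distrib, hl1,
            ← Finset.sum_div, ← Finset.mul_sum, htot]
          field_simp
          ring

/-! ### The auto-encoder -/

section AutoEncoder

variable {N K : ℕ}

/-- The isometry `|b⟩ ↦ |0⟩ ⊗ |b⟩` of the latent space into the register. -/
def latentIsometry (N K : ℕ) : Matrix (Register N K) (Qubits K) ℂ :=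
  Matrix.of fun x b => if x = (0, b) then 1 else 0

theorem latentIsometry_mul_conjTranspose :
    latentIsometry N K * (latentIsometry N K)ᴴ = zeroProj N K := by
  ext ⟨e, a⟩ ⟨e', b⟩
  rw [Matrix.mul_apply, zeroProj, Matrix.kroneckerMap_apply, Finset.sum_eq_single a]
  · have h : Matrix.single (0 : Qubits (N - K)) 0 (1 : ℂ) e e' =
        (if e = 0 then 1 else 0) * if e' = 0 then 1 else 0 := by
      rw [Matrix.single_apply, ite_and]
      simp only [eq_comm (a := (0 : Qubits (N - K))), ite_mul, one_mul, zero_mul]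
    rw [h, Matrix.one_apply]
    by_cases h3 : a = b
    · simp [latentIsometry, h3]
    · simp [latentIsometry, h3, Ne.symm h3]
  · intro c _ hc
    simp [latentIsometry, Ne.symm hc]
  · simp

theorem partialTraceE_latentIsometry (A : Matrix (Qubits K) (Qubits K) ℂ) :
    partialTraceE (latentIsometry N K * A * (latentIsometry N K)ᴴ) = A := by
  ext a b
  have h : ∀ e : Qubits (N - K), (latentIsometry N K * A * (latentIsometry N K)ᴴ) (e, a) (e, b) =
      if e = 0 then A a b else 0 := fun e => by
    rw [Matrix.mul_apply, Finset.sum_eq_single b, Matrix.mul_apply, Finset.sum_eq_single a]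
    · by_cases he : e = 0 <;> simp [latentIsometry, he]
    · intro c _ hc
      simp [latentIsometry, Ne.symm hc]
    · simp
    · intro c _ hc
      simp [latentIsometry, Ne.symm hc]
    · simp
  simp [partialTraceE, h]

theorem conjTranspose_latentIsometry_mul :
    (latentIsometry N K)ᴴ * latentIsometry N K = 1 := by
  ext a b
  rw [Matrix.mul_apply, Finset.sum_eq_single (0, a)]
  · by_cases h : a = b <;> simp [latentIsometry, Matrix.one_apply, h]
  · intro x _ hx
    simp [latentIsometry, hx]
  · simp

theorem trace_conj_unitary (U : Matrix.unitaryGroup (Register N K) ℂ)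
    (ρ : Matrix (Register N K) (Register N K) ℂ) : (U.1 * ρ * U.1ᴴ).trace = ρ.trace := by
  rw [Matrix.trace_mul_comm, ← Matrix.mul_assoc, conjTranspose_mul_coe, Matrix.one_mul]

/-- The compressed state is a multiple of the compression of `ρ` by the isometry
`Uᴴ * latentIsometry N K`. -/
theorem compressedState_eq (U ρ : Matrix (Register N K) (Register N K) ℂ) :
    compressedState U ρ = (zeroProj N K * (U * ρ * Uᴴ)).trace.re⁻¹ •
      ((Uᴴ * latentIsometry N K)ᴴ * ρ * (Uᴴ * latentIsometry N K)) := by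
  rw [compressedState]
  generalize (zeroProj N K * (U * ρ * Uᴴ)).trace.re⁻¹ = c
  rw [← partialTraceE_latentIsometry (N := N) (K := K)
    (c • ((Uᴴ * latentIsometry N K)ᴴ * ρ * (Uᴴ * latentIsometry N K)))]
  congr 1
  simp only [← latentIsometry_mul_conjTranspose, Matrix.conjTranspose_mul,
    Matrix.conjTranspose_conjTranspose, Matrix.mul_smul, Matrix.smul_mul, Matrix.mul_assoc]

/-- The truncated entropy of the compressed state exceeds the von Neumann entropy of `ρ` by at most
`(C_0 + 1) * δ`, with `δ` the loss. Truncation itself lowers the entropy, so only the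
compression contributes. -/
theorem sum_truncCoeff_qaeEigenvalues_le (R : ℕ) (U : Matrix.unitaryGroup (Register N K) ℂ)
    {ρ : Matrix (Register N K) (Register N K) ℂ} (hρ : IsDensityMatrix ρ)
    (hδ1 : qaeLoss U.1 ρ < 1) :
    0 ≤ qaeLoss U.1 ρ ∧
    ∑ j ∈ Finset.range (R + 1), truncCoeff R j *
        ∑ i, qaeEigenvalues U.1 hρ.1.isHermitian i ^ (j + 1) ≤
      vonNeumannEntropy ρ + (truncCoeff R 0 + 1) * qaeLoss U.1 ρ := by
  set δ := qaeLoss U.1 ρ with hδ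
  set Y := U.1ᴴ * latentIsometry N K with hY
  have hYY : Yᴴ * Y = 1 := by
    rw [hY, Matrix.conjTranspose_mul, Matrix.conjTranspose_conjTranspose, Matrix.mul_assoc,
      ← Matrix.mul_assoc U.1, coe_mul_conjTranspose, Matrix.one_mul,
      conjTranspose_latentIsometry_mul]
  have hρY : (Yᴴ * ρ * Y).PosSemidef := hρ.1.conjTranspose_mul_mul_same Y
  have htrY : (zeroProj N K * (U.1 * ρ * U.1ᴴ)).trace = (Yᴴ * ρ * Y).trace := by
    rw [← latentIsometry_mul_conjTranspose, Matrix.mul_assoc, Matrix.trace_mul_comm, hY,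
      Matrix.conjTranspose_mul, Matrix.conjTranspose_conjTranspose]
    simp only [Matrix.mul_assoc]
  have hκ : (zeroProj N K * (U.1 * ρ * U.1ᴴ)).trace.re = 1 - δ := by
    rw [hδ, qaeLoss, measG, Matrix.sub_mul, Matrix.one_mul, Matrix.trace_sub, trace_conj_unitary,
      hρ.2, Complex.sub_re, Complex.one_re, sub_sub_cancel]
  have hδ' : 0 < 1 - δ := by linarith
  have hσ : compressedState U.1 ρ = ((1 - δ)⁻¹ : ℝ) • (Yᴴ * ρ * Y) := by
    rw [compressedState_eq, hκ]
  have hσH := compressedState_isHermitian U.1 hρ.1.isHermitian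
  have hσpos : (compressedState U.1 ρ).PosSemidef := by
    rw [hσ]
    exact hρY.smul (inv_nonneg.2 hδ'.le)
  have hQ := eq_ofSpectrum hσH
  change _ = ofSpectrum _ (qaeEigenvalues U.1 hρ.1.isHermitian) at hQ
  set μ := qaeEigenvalues U.1 hρ.1.isHermitian with hμdef
  set Q := hσH.eigenvectorUnitary
  have hμ : ∀ i, 0 ≤ μ i := hσpos.eigenvalues_nonneg
  have hμ1 : ∑ i, μ i = 1 := by
    have h := congrArg (fun A => A.trace.re) (hQ.symm.trans hσ)
    simp only [trace_ofSpectrum, Complex.ofReal_re, Matrix.trace_smul, Complex.smul_re, ← htrY, hκ,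
      smul_eq_mul] at h
    rw [h, inv_mul_cancel₀ hδ'.ne']
  have hB := eq_ofSpectrum hρ.1.isHermitian
  have hl := hρ.1.eigenvalues_nonneg
  set B := hρ.1.isHermitian.eigenvectorUnitary
  set l := hρ.1.isHermitian.eigenvalues
  have hl1 : ∑ j, l j = 1 := by
    have h := hρ.2
    rw [hB, trace_ofSpectrum] at h
    exact_mod_cast h
  -- in eigenbases of `ρ` and of the compressed state the compression is the isometry `G`
  set G := B.1ᴴ * Y * Q.1 with hGdef
  have hG : Gᴴ * G = 1 := by
    calc Gᴴ * G = Q.1ᴴ * (Yᴴ * (B.1 * B.1ᴴ) * Y) * Q.1 := by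
          simp only [hGdef, Matrix.conjTranspose_mul, Matrix.conjTranspose_conjTranspose,
            Matrix.mul_assoc]
      _ = 1 := by
          rw [coe_mul_conjTranspose, Matrix.mul_one, hYY, Matrix.mul_one, conjTranspose_mul_coe]
  have hc : Gᴴ * Matrix.diagonal (fun j => (l j : ℂ)) * G =
      Matrix.diagonal fun i => (((1 - δ) * μ i : ℝ) : ℂ) := by
    calc Gᴴ * Matrix.diagonal (fun j => (l j : ℂ)) * G =
          Q.1ᴴ * (Yᴴ * ofSpectrum B l * Y) * Q.1 := by
          simp only [hGdef, ofSpectrum_eq, Matrix.conjTranspose_mul,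
            Matrix.conjTranspose_conjTranspose, Matrix.mul_assoc]
      _ = Q.1ᴴ * ofSpectrum Q (fun i => (1 - δ) * μ i) * Q.1 := by
          rw [← hB, ← smul_ofSpectrum, ← hQ, hσ, Complex.coe_smul, smul_inv_smul₀ hδ'.ne']
      _ = _ := conj_ofSpectrum Q _
  obtain ⟨hδ0, hcomp⟩ := sum_truncEntropyFun_le_of_compression R hG hl hl1 hμ hμ1 hδ1 hc
  refine ⟨hδ0, ?_⟩
  have hS : ∑ j, truncEntropyFun R (l j) ≤ vonNeumannEntropy ρ := by
    rw [hB, vonNeumannEntropy_ofSpectrum, ← Finset.sum_neg_distrib]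
    exact Finset.sum_le_sum fun j _ =>
      truncEntropyFun_le_negMulLog R (hl j) (le_one_of_sum_eq_one hl hl1 j)
  have hswap : ∑ j ∈ Finset.range (R + 1), truncCoeff R j * ∑ i, μ i ^ (j + 1) =
      ∑ i, truncEntropyFun R (μ i) := by
    simp only [← sum_truncCoeff_mul_pow, Finset.mul_sum]
    exact Finset.sum_comm
  rw [hswap]
  linarith

end AutoEncoder

end QAEGibbs

theorem mainTheorem5
    (N K : ℕ) (hK : K < N)
    (H : Matrix (QAEGibbs.Register N K) (QAEGibbs.Register N K) ℂ) (hH : H.IsHermitian)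
    (β : ℝ) (hβ : 0 < β)
    (R : ℕ) (hR : 1 ≤ R)
    -- the parametrized states, the parametrized encoder, and the trained parameters
    {Γ Θ : Type*}
    (ρ : Γ → Matrix (QAEGibbs.Register N K) (QAEGibbs.Register N K) ℂ)
    (hρ : ∀ γ, QAEGibbs.IsDensityMatrix (ρ γ))
    (U : Θ → Matrix.unitaryGroup (QAEGibbs.Register N K) ℂ)
    (γhat : Γ) (θhat : Θ)
    -- the training loss of the auto-encoder
    (δ : ℝ) (hδ : QAEGibbs.qaeLoss (U θhat).1 (ρ γhat) = δ) (hδ1 : δ < 1)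
    -- the tolerable error
    (ε₁ : ℝ) (hε₁ : 0 ≤ ε₁)
    (hopt : QAEGibbs.qaeTruncFreeEnergy β H R (U θhat).1 (hρ γhat).1.isHermitian ≤
      QAEGibbs.freeEnergy β H (QAEGibbs.gibbsState β H) + ε₁)
    (Δ : ℝ) (hΔ0 : 0 < Δ) (hΔ1 : Δ < Real.exp (-1))
    (r : ℕ) (hr : (ρ γhat).rank = r)
    (ε : ℝ) (hε : ε = ε₁ + 2 * r / (R + 1) * (1 - Δ) ^ (R + 1)) :
    (∀ Cmax : ℝ, IsGreatest (QAEGibbs.truncCoeff R '' Set.Icc 0 R) Cmax →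
      1 - √(2 * β * ε + Cmax * δ / (1 - δ)) ≤
        QAEGibbs.fidelity (QAEGibbs.gibbsState β H) (ρ γhat)) ∧
    (2 ≤ R → ∀ Cmax : ℝ, IsGreatest (QAEGibbs.truncCoeff R '' Set.Icc 1 R) Cmax →
      1 - √(2 * β * ε + Cmax * δ / (1 - δ)) ≤
        QAEGibbs.fidelity (QAEGibbs.gibbsState β H) (ρ γhat)) := by
  obtain ⟨hδ0, hS⟩ := QAEGibbs.sum_truncCoeff_qaeEigenvalues_le R (U θhat) (hρ γhat)
    (hδ.trans_lt hδ1)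
  rw [hδ] at hδ0 hS
  -- the truncation term of `ε` has the favourable sign
  have hε₁ε : ε₁ ≤ ε := by
    have h1 : Δ < 1 :=
      hΔ1.trans ((Real.exp_lt_exp.2 (by norm_num : (-1 : ℝ) < 0)).trans_eq Real.exp_zero)
    have h2 : 0 ≤ (1 - Δ) ^ (R + 1) := pow_nonneg (by linarith) _
    have h3 : 0 ≤ 2 * (r : ℝ) / (R + 1) * (1 - Δ) ^ (R + 1) := by positivity
    linarith
  have hD : β * (QAEGibbs.freeEnergy β H (ρ γhat) -
      QAEGibbs.freeEnergy β H (QAEGibbs.gibbsState β H)) ≤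
      β * ε₁ + (QAEGibbs.truncCoeff R 0 + 1) * δ := by
    have h := mul_le_mul_of_nonneg_left hopt hβ.le
    rw [QAEGibbs.qaeTruncFreeEnergy, mul_sub, mul_inv_cancel_left₀ hβ.ne'] at h
    rw [mul_sub β, QAEGibbs.freeEnergy, mul_sub β, mul_inv_cancel_left₀ hβ.ne']
    linarith
  have hmain : ∀ C : ℝ, 1 / 4 ≤ C → QAEGibbs.truncCoeff R 0 ≤ 1 + C →
      1 - √(2 * β * ε + C * δ / (1 - δ)) ≤
        QAEGibbs.fidelity (QAEGibbs.gibbsState β H) (ρ γhat) := fun C hC hC₀ => by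
    rw [mul_assoc 2 β]
    exact (QAEGibbs.one_sub_sqrt_le_exp (mul_nonneg hβ.le hε₁)
      (mul_le_mul_of_nonneg_left hε₁ε hβ.le) hC hC₀ hδ0 hδ1 hD).trans
      (QAEGibbs.exp_neg_freeEnergy_sub_le_fidelity hH hβ (hρ γhat))
  refine ⟨fun C hC => ?_, fun hR2 C hC => ?_⟩
  · have h0 : QAEGibbs.truncCoeff R 0 ≤ C := hC.2 ⟨0, ⟨le_rfl, by omega⟩, rfl⟩
    have h1 : 1 ≤ QAEGibbs.truncCoeff R 0 := by
      rw [QAEGibbs.truncCoeff, if_pos rfl]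
      refine le_trans ?_ (Finset.single_le_sum (f := fun k : ℕ => 1 / (k : ℝ))
        (fun k _ => by positivity) (Finset.mem_Icc.2 ⟨le_rfl, hR⟩))
      norm_num
    exact hmain C (by linarith) (by linarith)
  · have h2 : QAEGibbs.truncCoeff R 2 ≤ C := hC.2 ⟨2, ⟨by omega, hR2⟩, rfl⟩
    obtain ⟨h3, h4⟩ := QAEGibbs.truncCoeff_two_bounds hR2
    exact hmain C (by linarith) (by linarith)
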